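/- Consider random matching markets with $n$ jobs and $m_n = n(1+\alpha_n)$ candidates, where $m_n$ is an integer, $\alpha_n > 0$ (so there are more candidates than jobs) and $\alpha_n = o(1)$ as $n \to \infty$. Let $d_n$ be integers with $1 \le d_n \le n$. In the market, each candidate has a preference list consisting of $d_n$ distinct jobs, chosen uniformly at random among all ordered lists of $d_n$ distinct jobs, and each job ranks the candidates by a uniformly random ranking; all these choices are independent. Run the candidate-proposing deferred acceptance algorithm: at each step an unmatched candidate who has not exhausted their list proposes to the most preferred job on the list to which they have not yet proposed, and the job keeps the better of this candidate and the candidate it currently holds (if any) and rejects the other. The rank of a candidate is the position (counted from $1$) on their list of the job they are matched to in the end; a candidate who ends up unmatched is given rank $d_n$. Then the expected rank of every candidate is at least $$(1-o(1))\,\frac{d_n}{\ln\left(\frac{1+\alpha_n}{\alpha_n + \frac{1}{n(1+\alpha_n)}}\right)},$$ where the $o(1)$ term tends to $0$ as $n\to\infty$ and does not depend on the candidate. -/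

import Mathlib

open Filter Topology BigOperators

namespace StableMarket

/-- A market with `m` candidates and `n` jobs in which every candidate has a preference list of
`d` jobs. `M.1 c i` is the job in position `i` of the list of candidate `c` (position `0` is the
most preferred one; the jobs on a list are distinct). `M.2 j c` is the position of candidate `c` in
the ranking of all candidates by job `j` (position `0` is the most preferred one); among the
candidates that list `j`, the job uses the induced order. -/
abbrev Market (n m d : ℕ) : Type :=
  (Fin m → (Fin d ↪ Fin n)) × (Fin n → Equiv.Perm (Fin m))

/-- A state of the deferred acceptance algorithm: how many proposals each candidate has made so
far, and which candidate (if any) each job currently holds. -/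
structure DAState (n m : ℕ) where
  proposed : Fin m → ℕ
  held : Fin n → Option (Fin m)

variable {n m d : ℕ}

/-- At the start nobody has proposed and no job holds a candidate. -/
def DAState.init (n m : ℕ) : DAState n m where
  proposed := fun _ => 0
  held := fun _ => none

/-- The candidates who are currently unmatched and have not yet proposed to every job on their
list (which has `d` jobs). -/
def DAState.active (d : ℕ) (s : DAState n m) : Finset (Fin m) :=
  Finset.univ.filter fun c => (∀ j, s.held j ≠ some c) ∧ s.proposed c < d

theorem DAState.proposed_lt {s : DAState n m} {c : Fin m} (h : c ∈ s.active d) :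
    s.proposed c < d :=
  (Finset.mem_filter.1 h).2.2

/-- What a job with ranking `σ` that holds `cur` holds after a proposal from candidate `c`. -/
def respond (σ : Equiv.Perm (Fin m)) (cur : Option (Fin m)) (c : Fin m) : Option (Fin m) :=
  match cur with
  | none => some c
  | some c' => if σ c < σ c' then some c else some c'

/-- Candidate `c` proposes to job `j`. -/
def DAState.propose (M : Market n m d) (s : DAState n m) (c : Fin m) (j : Fin n) :
    DAState n m where
  proposed := Function.update s.proposed c (s.proposed c + 1)
  held := Function.update s.held j (respond (M.2 j) (s.held j) c)

/-- One step of candidate-proposing deferred acceptance: the active candidate with the lowest index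
proposes to the most preferred job on their list to which they have not yet proposed. The state is
left unchanged if no candidate is active. -/
def DAState.step (M : Market n m d) (s : DAState n m) : DAState n m :=
  if h : (s.active d).Nonempty then
    s.propose M ((s.active d).min' h)
      (M.1 ((s.active d).min' h) ⟨_, DAState.proposed_lt (Finset.min'_mem _ h)⟩)
  else s

/-- The final state of candidate-proposing deferred acceptance. At most `m * d` proposals can be
made, so that the algorithm has stopped after this many steps, see `active_cpda`. -/
def cpda (M : Market n m d) : DAState n m :=
  (DAState.step M)^[m * d] (DAState.init n m)

/-- When `cpda` stops, every candidate is matched or has exhausted their list. -/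
theorem active_cpda (M : Market n m d) : (cpda M).active d = ∅ := by
  have key : ∀ k : ℕ, let s := (DAState.step M)^[k] (DAState.init n m)
      (∀ c, s.proposed c ≤ d) ∧ (s.active d = ∅ ∨ ∑ c, s.proposed c = k) := by
    intro k
    induction k with
    | zero => simp [DAState.init]
    | succ k ih =>
      rw [Function.iterate_succ_apply']
      obtain ⟨h1, h2⟩ := ih
      set s := (DAState.step M)^[k] (DAState.init n m)
      by_cases h : (s.active d).Nonempty
      · have hlt := DAState.proposed_lt (Finset.min'_mem _ h)
        have h3 : ∑ c, s.proposed c = k :=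
          h2.resolve_left h.ne_empty
        simp only [DAState.step, dif_pos h, DAState.propose]
        refine ⟨fun c => ?_, Or.inr ?_⟩
        · by_cases hc : c = (s.active d).min' h
          · rw [hc, Function.update_self]; exact hlt
          · rw [Function.update_of_ne hc]; exact h1 c
        · rw [Finset.sum_update_of_mem (Finset.mem_univ _), ← h3,
            ← Finset.add_sum_erase _ _ (Finset.mem_univ ((s.active d).min' h)),
            ← Finset.sdiff_singleton_eq_erase]
          ring
      · simp only [DAState.step, dif_neg h]
        exact ⟨h1, Or.inl (Finset.not_nonempty_iff_eq_empty.1 h)⟩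
  obtain ⟨h1, h2⟩ := key (m * d)
  rcases h2 with h2 | h2
  · exact h2
  · by_contra hne
    obtain ⟨c, hc⟩ := Finset.nonempty_iff_ne_empty.2 hne
    have hlt : (cpda M).proposed c < d := DAState.proposed_lt hc
    have : ∑ c, (cpda M).proposed c < ∑ _c : Fin m, d :=
      Finset.sum_lt_sum (fun c _ => h1 c) ⟨c, Finset.mem_univ _, hlt⟩
    simp only [Finset.sum_const, Finset.card_univ, Fintype.card_fin, smul_eq_mul] at this
    exact absurd h2 this.ne

/-- The rank of candidate `c` in the outcome of candidate-proposing deferred acceptance: the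
position, counted from `1`, on the list of `c` of the job matched to `c`. An unmatched candidate
has been rejected by all `d` jobs on their list and is assigned the rank `d`, the smallest of the
usual conventions (with it the rank of `c` is the number of proposals that `c` makes). -/
def candidateRank (M : Market n m d) (c : Fin m) : ℕ :=
  if h : ∃ i : Fin d, (cpda M).held (M.1 c i) = some c then (Fin.find _ h : ℕ) + 1 else d

/-- The expected rank of candidate `c` if all preference lists of the candidates and all rankings of
the jobs are chosen uniformly and independently, that is, if all markets are equally likely. -/
noncomputable def expectedRank (n m d : ℕ) (c : Fin m) : ℝ :=
  (∑ M : Market n m d, (candidateRank M c : ℝ)) / (Fintype.card (Market n m d) : ℝ)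

end StableMarket

/-!
The expected rank is bounded from below through the set of jobs that candidate `c` could get.

*Menu.* Let the jobs propose and let `c` reject everybody. The numbers `finalAsked M c` of candidates
whom the jobs ask in this process do not depend on the list of `c`, and every job that `c` can be
matched to by candidate-proposing deferred acceptance is one that asks `c` (`asked_of_cpda_held`). So
the rank of `c` is at least the position of the first job on the list of `c` that asks `c` (and `d` if
there is none). As the order of this list is uniformly random, the expected rank is at least
`d / (Y + 1)` given the number `Y` of such jobs (`le_sum_perm_card_leading`). This is convex in `Y`, so
that by Jensen's inequality only an upper bound on the expectation of `Y` is needed, and no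
concentration.

*Coupon collector.* In the process, call a candidate other than `c` fresh if no job on its list has
asked it. Exchanging `c` with a fresh candidate `i` at the moment at which `c` is asked by a job on its
list is injective and turns the event into one in which `i` is asked by a job on its list and is fresh
no more (`asksAt_exchange`). Give weight `1 / #fresh` to each candidate that is fresh at this moment.
Then the expectation of `Y` is at most the sum of `1 / u` over the successive numbers `u` of fresh
candidates. They go down from `m - 1` and stay above `m - 1 - n`, since the candidates that hold a job
are at most `n`. Hence `Y` has expectation at most `harmonic (m - 1) - harmonic (m - 1 - n)`
(`sum_card_hits_le`), which is `log (m / (m - n)) + O(1)`. With `m = n (1 + α)` this exceeds the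
logarithm `L` in the theorem by at most a constant, and `L` tends to infinity.
-/

open Filter Topology BigOperators

namespace StableMarket

variable {n m d : ℕ}

/-! ### Stability of the outcome of deferred acceptance -/

theorem respond_spec (σ : Equiv.Perm (Fin m)) (cur : Option (Fin m)) (c : Fin m) :
    ∃ c', respond σ cur c = some c' ∧ σ c' ≤ σ c ∧ (∀ b, cur = some b → σ c' ≤ σ b) ∧
      (c' = c ∨ cur = some c') := by
  cases cur with
  | none => exact ⟨c, rfl, le_rfl, by simp, Or.inl rfl⟩
  | some b =>
    by_cases h : σ c < σ b
    · exact ⟨c, by simp [respond, h], le_rfl, by simpa using h.le, Or.inl rfl⟩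
    · exact ⟨b, by simp [respond, h], not_lt.1 h, by simp, Or.inr rfl⟩

theorem step_iterate_invariant (M : Market n m d) (t : ℕ) :
    (∀ c (k : Fin d), (k : ℕ) < ((DAState.step M)^[t] (DAState.init n m)).proposed c →
      ∃ c', ((DAState.step M)^[t] (DAState.init n m)).held (M.1 c k) = some c' ∧
        M.2 (M.1 c k) c' ≤ M.2 (M.1 c k) c) ∧
    (∀ j c, ((DAState.step M)^[t] (DAState.init n m)).held j = some c →
      ∃ k : Fin d, (k : ℕ) + 1 = ((DAState.step M)^[t] (DAState.init n m)).proposed c ∧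
        M.1 c k = j) := by
  induction t with
  | zero => simp [DAState.init]
  | succ t ih =>
    rw [Function.iterate_succ_apply']
    obtain ⟨h1, h2⟩ := ih
    set s := (DAState.step M)^[t] (DAState.init n m)
    by_cases h : (s.active d).Nonempty
    · have hmem := Finset.min'_mem _ h
      have hlt := DAState.proposed_lt hmem
      simp only [DAState.step, dif_pos h, DAState.propose]
      set b := (s.active d).min' h
      have hb : ∀ j, s.held j ≠ some b := (Finset.mem_filter.1 hmem).2.1
      set k₀ : Fin d := ⟨s.proposed b, hlt⟩ with hk₀
      obtain ⟨b', hr, hle, hle', hor⟩ := respond_spec (M.2 (M.1 b k₀)) (s.held (M.1 b k₀)) b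
      rw [hr]
      refine ⟨fun c k hk => ?_, fun j c hj => ?_⟩
      · have hcase : (k : ℕ) < s.proposed c ∨ (c = b ∧ k = k₀) := by
          by_cases hc : c = b
          · subst hc
            rw [Function.update_self] at hk
            rcases Nat.lt_succ_iff_lt_or_eq.1 hk with hk | hk
            · exact Or.inl hk
            · exact Or.inr ⟨rfl, Fin.ext hk⟩
          · rw [Function.update_of_ne hc] at hk
            exact Or.inl hk
        by_cases hj : M.1 c k = M.1 b k₀
        · rw [hj, Function.update_self]
          refine ⟨b', rfl, ?_⟩
          rcases hcase with hk | ⟨rfl, rfl⟩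
          · obtain ⟨c', hc', hl⟩ := h1 c k hk
            rw [hj] at hc' hl
            exact (hle' c' hc').trans hl
          · exact hle
        · rw [Function.update_of_ne hj]
          rcases hcase with hk | ⟨rfl, rfl⟩
          · exact h1 c k hk
          · exact absurd rfl hj
      · by_cases hj0 : j = M.1 b k₀
        · subst hj0
          rw [Function.update_self, Option.some_inj] at hj
          subst hj
          by_cases hc : b' = b
          · rw [hc, Function.update_self]
            exact ⟨k₀, rfl, rfl⟩
          · rw [Function.update_of_ne hc]
            exact h2 _ _ (hor.resolve_left hc)
        · rw [Function.update_of_ne hj0] at hj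
          have hc : c ≠ b := fun hc => hb j (hc ▸ hj)
          rw [Function.update_of_ne hc]
          exact h2 _ _ hj
    · simp only [DAState.step, dif_neg h]
      exact ⟨h1, h2⟩

/-- Stability of the outcome for matched candidates: every job that `c` likes at least as much as
the own match holds a candidate that it likes at least as much as `c`. -/
theorem cpda_held {M : Market n m d} {j : Fin n} {c : Fin m} (h : (cpda M).held j = some c) :
    ∃ k, M.1 c k = j ∧ ∀ k' ≤ k, ∃ c', (cpda M).held (M.1 c k') = some c' ∧
      M.2 (M.1 c k') c' ≤ M.2 (M.1 c k') c := by
  obtain ⟨h1, h2⟩ := step_iterate_invariant M (m * d)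
  obtain ⟨k, hk, hj⟩ := h2 j c h
  exact ⟨k, hj, fun k' hk' => h1 c k' (by have : (k' : ℕ) ≤ k := hk'; omega)⟩

/-- Stability of the outcome for unmatched candidates. -/
theorem cpda_unmatched {M : Market n m d} {c : Fin m} (h : ∀ j, (cpda M).held j ≠ some c)
    (k : Fin d) : ∃ c', (cpda M).held (M.1 c k) = some c' ∧
      M.2 (M.1 c k) c' ≤ M.2 (M.1 c k) c := by
  obtain ⟨h1, -⟩ := step_iterate_invariant M (m * d)
  refine h1 c k ?_
  have hc : c ∉ (cpda M).active d := by simp [active_cpda]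
  simp only [DAState.active, Finset.mem_filter, Finset.mem_univ, true_and, not_and, not_lt] at hc
  exact k.2.trans_le (hc h)

/-! ### Job-proposing deferred acceptance in the absence of one candidate -/

/-- Jobs ask the candidates one after the other in the order of their rankings, and `s j` is the
number of candidates that job `j` has asked. `Reached M c s i k` says that candidate `i` has been
asked by the job in position `k` of the list of `i`. The candidate `c` ignores all jobs. -/
def Reached (M : Market n m d) (c : Fin m) (s : Fin n → ℕ) (i : Fin m) (k : Fin d) : Prop :=
  i ≠ c ∧ (M.2 (M.1 i k) i : ℕ) < s (M.1 i k)

/-- Candidate `i` holds job `j`: it is the first job on the list of `i` among those that have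
asked `i`. -/
def Holds (M : Market n m d) (c : Fin m) (s : Fin n → ℕ) (i : Fin m) (j : Fin n) : Prop :=
  ∃ k, M.1 i k = j ∧ Reached M c s i k ∧ ∀ k' < k, ¬ Reached M c s i k'

open Classical in
/-- The jobs that no candidate holds and that have not yet asked all `m` candidates. -/
noncomputable def freeJobs (M : Market n m d) (c : Fin m) (s : Fin n → ℕ) : Finset (Fin n) :=
  Finset.univ.filter fun j => (∀ i, ¬ Holds M c s i j) ∧ s j < m

open Classical in
/-- The candidates other than `c` that no job on their list has asked. -/
noncomputable def fresh (M : Market n m d) (c : Fin m) (s : Fin n → ℕ) : Finset (Fin m) :=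
  Finset.univ.filter fun i => i ≠ c ∧ ∀ k, ¬ Reached M c s i k

/-- The job of lowest index in `F`, if any, asks one more candidate. -/
def advance (F : Finset (Fin n)) (s : Fin n → ℕ) : Fin n → ℕ :=
  if h : F.Nonempty then Function.update s (F.min' h) (s (F.min' h) + 1) else s

/-- The numbers of candidates that the jobs have asked after `t` steps of job-proposing deferred
acceptance in which the candidate `c` rejects everybody. -/
noncomputable def asked (M : Market n m d) (c : Fin m) : ℕ → Fin n → ℕ
  | 0 => fun _ => 0
  | t + 1 => advance (freeJobs M c (asked M c t)) (asked M c t)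

/-- Each of the `n` jobs asks at most `m` candidates, so that the process has stopped after
`n * m` steps. -/
noncomputable def finalAsked (M : Market n m d) (c : Fin m) : Fin n → ℕ := asked M c (n * m)

theorem advance_cases (F : Finset (Fin n)) (s : Fin n → ℕ) :
    (F = ∅ ∧ advance F s = s) ∨ ∃ j ∈ F, advance F s = Function.update s j (s j + 1) := by
  by_cases h : F.Nonempty
  · exact Or.inr ⟨F.min' h, F.min'_mem h, by simp [advance, h]⟩
  · exact Or.inl ⟨Finset.not_nonempty_iff_eq_empty.1 h, by simp [advance, h]⟩

theorem le_advance (F : Finset (Fin n)) (s : Fin n → ℕ) : s ≤ advance F s := by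
  rcases advance_cases F s with ⟨-, h⟩ | ⟨j, -, h⟩
  · rw [h]
  · rw [h]; exact le_update_self_iff.2 (Nat.le_succ _)

theorem asked_mono (M : Market n m d) (c : Fin m) : Monotone (asked M c) :=
  monotone_nat_of_le_succ fun _ => le_advance _ _

theorem mem_freeJobs {M : Market n m d} {c : Fin m} {s : Fin n → ℕ} {j : Fin n} :
    j ∈ freeJobs M c s ↔ (∀ i, ¬ Holds M c s i j) ∧ s j < m := by
  simp [freeJobs]

theorem mem_fresh {M : Market n m d} {c : Fin m} {s : Fin n → ℕ} {i : Fin m} :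
    i ∈ fresh M c s ↔ i ≠ c ∧ ∀ k, ¬ Reached M c s i k := by
  simp [fresh]

theorem Reached.mono {M : Market n m d} {c : Fin m} {s s' : Fin n → ℕ} (h : s ≤ s')
    {i : Fin m} {k : Fin d} (hr : Reached M c s i k) : Reached M c s' i k :=
  ⟨hr.1, hr.2.trans_le (h _)⟩

theorem fresh_anti (M : Market n m d) (c : Fin m) {s s' : Fin n → ℕ} (h : s ≤ s') :
    fresh M c s' ⊆ fresh M c s := fun i hi => by
  rw [mem_fresh] at hi ⊢
  exact ⟨hi.1, fun k hk => hi.2 k (hk.mono h)⟩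

theorem Holds.unique {M : Market n m d} {c : Fin m} {s : Fin n → ℕ} {i : Fin m} {j j' : Fin n}
    (h : Holds M c s i j) (h' : Holds M c s i j') : j = j' := by
  obtain ⟨k, rfl, hk, hmin⟩ := h
  obtain ⟨k', rfl, hk', hmin'⟩ := h'
  rw [le_antisymm (not_lt.1 fun h => hmin k' h hk') (not_lt.1 fun h => hmin' k h hk)]

/-- A job that is held has been accepted by the last candidate that it asked. -/
theorem Holds.asked_eq {M : Market n m d} {c : Fin m} {t : ℕ} :
    ∀ {i : Fin m} {j : Fin n}, Holds M c (asked M c t) i j →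
      asked M c t j = (M.2 j i : ℕ) + 1 := by
  induction t with
  | zero =>
    rintro i j ⟨k, -, hk, -⟩
    exact absurd hk.2 (Nat.not_lt_zero _)
  | succ t ih =>
    rintro i j ⟨k, rfl, hk, hmin⟩
    have hmin' : ∀ k' < k, ¬ Reached M c (asked M c t) i k' := fun k' hk' hr =>
      hmin k' hk' (hr.mono (asked_mono M c t.le_succ))
    by_cases hr : Reached M c (asked M c t) i k
    · have hh : Holds M c (asked M c t) i (M.1 i k) := ⟨k, rfl, hr, hmin'⟩
      rw [← ih hh]
      rcases advance_cases (freeJobs M c (asked M c t)) (asked M c t) with ⟨-, h⟩ | ⟨j, hj, h⟩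
      · exact congrFun h _
      · have hne : M.1 i k ≠ j := by
          rintro rfl
          exact (mem_freeJobs.1 hj).1 i hh
        exact (congrFun h _).trans (Function.update_of_ne hne _ _)
    · have hle : asked M c t (M.1 i k) ≤ M.2 (M.1 i k) i := not_lt.1 fun h => hr ⟨hk.1, h⟩
      have hlt := hk.2
      rcases advance_cases (freeJobs M c (asked M c t)) (asked M c t) with ⟨-, h⟩ | ⟨j, hj, h⟩
      · change _ < advance _ _ _ at hlt
        rw [h] at hlt
        omega
      · change _ < advance _ _ _ at hlt
        change advance _ _ _ = _
        rw [h] at hlt ⊢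
        by_cases hne : M.1 i k = j
        · subst hne
          rw [Function.update_self] at hlt ⊢
          omega
        · rw [Function.update_of_ne hne] at hlt
          omega

theorem Holds.candidate_unique {M : Market n m d} {c : Fin m} {t : ℕ} {i i' : Fin m} {j : Fin n}
    (h : Holds M c (asked M c t) i j) (h' : Holds M c (asked M c t) i' j) : i = i' := by
  have h1 := h.asked_eq
  have h2 := h'.asked_eq
  exact (M.2 j).injective (Fin.ext (by omega))

theorem exists_holds {M : Market n m d} {c : Fin m} {s : Fin n → ℕ} {i : Fin m} (hi : i ≠ c)
    (h : i ∉ fresh M c s) : ∃ j, Holds M c s i j := by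
  classical
  have h' : ∃ k, Reached M c s i k := by
    by_contra hne
    exact h (mem_fresh.2 ⟨hi, not_exists.1 hne⟩)
  exact ⟨M.1 i (Fin.find _ h'), Fin.find _ h', rfl, Fin.find_spec h',
    fun k' hk' => Fin.find_min h' hk'⟩

theorem freeJobs_finalAsked (M : Market n m d) (c : Fin m) :
    freeJobs M c (finalAsked M c) = ∅ := by
  have key : ∀ t, (∀ j, asked M c t j ≤ m) ∧
      (freeJobs M c (asked M c t) = ∅ ∨ ∑ j, asked M c t j = t) := by
    intro t
    induction t with
    | zero => simp [asked]
    | succ t ih =>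
      rcases advance_cases (freeJobs M c (asked M c t)) (asked M c t) with ⟨h0, h⟩ | ⟨j, hj, h⟩
      · have h' : asked M c (t + 1) = asked M c t := h
        rw [h']
        exact ⟨ih.1, Or.inl h0⟩
      · have h' : asked M c (t + 1) = Function.update (asked M c t) j (asked M c t j + 1) := h
        have h3 := ih.2.resolve_left (Finset.ne_empty_of_mem hj)
        rw [h']
        refine ⟨fun j' => ?_, Or.inr ?_⟩
        · by_cases hne : j' = j
          · rw [hne, Function.update_self]; exact (mem_freeJobs.1 hj).2
          · rw [Function.update_of_ne hne]; exact ih.1 j'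
        · rw [Finset.sum_update_of_mem (Finset.mem_univ _), Finset.sdiff_singleton_eq_erase]
          have := Finset.add_sum_erase _ (asked M c t) (Finset.mem_univ j)
          omega
  obtain ⟨h1, h2⟩ := key (n * m)
  rcases h2 with h2 | h2
  · exact h2
  · refine Finset.eq_empty_of_forall_notMem fun j hj => ?_
    have : ∑ j, asked M c (n * m) j < ∑ _j : Fin n, m :=
      Finset.sum_lt_sum (fun j _ => h1 j) ⟨j, Finset.mem_univ _, (mem_freeJobs.1 hj).2⟩
    simp [h2] at this

/-- If `F` contains all jobs that are held, then at most `#F` candidates hold a job, and the others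
are fresh, except for `c`. -/
theorem card_le_card_fresh_add (M : Market n m d) (c : Fin m) (t : ℕ) {F : Finset (Fin n)}
    (hF : ∀ i j, Holds M c (asked M c t) i j → j ∈ F) :
    m - 1 ≤ (fresh M c (asked M c t)).card + F.card := by
  classical
  have hcard : (Finset.univ.erase c \ fresh M c (asked M c t)).card ≤ F.card := by
    refine Finset.card_le_card_of_forall_subsingleton (Holds M c (asked M c t)) ?_ ?_
    · intro i hi
      rw [Finset.mem_sdiff, Finset.mem_erase] at hi
      obtain ⟨j, hj⟩ := exists_holds hi.1.1 hi.2
      exact ⟨j, hF i j hj, hj⟩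
    · intro j _ i hi i' hi'
      exact hi.2.candidate_unique hi'.2
  have h1 := Finset.le_card_sdiff (fresh M c (asked M c t)) (Finset.univ.erase c)
  rw [Finset.card_erase_of_mem (Finset.mem_univ _), Finset.card_univ, Fintype.card_fin] at h1
  omega

/-- If candidate-proposing deferred acceptance matches `c` to `j`, then `j` asks `c` when the jobs
propose and `c` rejects everybody. Otherwise `j` belongs to the set of the jobs that are better off
in the second process. For each such job, the candidate who holds it in the second process gets a
better job in the first one, and that job is again better off in the second process. This defines
an injective map of the set into itself, but `j` is not in its image, since `c` holds no job in the
second process. -/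
theorem asked_of_cpda_held {M : Market n m d} {c : Fin m} {j : Fin n}
    (h : (cpda M).held j = some c) : (M.2 j c : ℕ) < finalAsked M c j := by
  by_contra hlt
  let Better : Fin n → Prop := fun j =>
    ∃ b, (cpda M).held j = some b ∧ finalAsked M c j ≤ (M.2 j b : ℕ)
  have key : ∀ j : {j // Better j}, ∃ j' : {j // Better j}, ∃ i,
      Holds M c (finalAsked M c) i j ∧ (cpda M).held j' = some i := by
    rintro ⟨j, b, hb, hle⟩
    have hj : j ∉ freeJobs M c (finalAsked M c) := by simp [freeJobs_finalAsked]
    rw [mem_freeJobs, not_and] at hj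
    obtain ⟨i, hi⟩ : ∃ i, Holds M c (finalAsked M c) i j := by
      by_contra hne
      exact hj (not_exists.1 hne) (hle.trans_lt (Fin.is_lt _))
    obtain ⟨k, rfl, hk, hmin⟩ := hi
    have hno : ¬ ∃ c', (cpda M).held (M.1 i k) = some c' ∧
        M.2 (M.1 i k) c' ≤ M.2 (M.1 i k) i := by
      rintro ⟨c', hc', hle'⟩
      rw [hb, Option.some_inj] at hc'
      subst hc'
      have h1 := hk.2
      have h2 : (M.2 (M.1 i k) b : ℕ) ≤ M.2 (M.1 i k) i := hle'
      omega
    by_cases hm : ∃ j', (cpda M).held j' = some i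
    · obtain ⟨j', hj'⟩ := hm
      obtain ⟨k', rfl, hk'⟩ := cpda_held hj'
      have hlt' : k' < k := lt_of_not_ge fun hge => hno (hk' k hge)
      refine ⟨⟨M.1 i k', i, hj', ?_⟩, i, ⟨k, rfl, hk, hmin⟩, hj'⟩
      exact not_lt.1 fun hr => hmin k' hlt' ⟨hk.1, hr⟩
    · exact absurd (cpda_unmatched (not_exists.1 hm) k) hno
  choose f g hg hf using key
  have hinj : Function.Injective f := by
    intro a b hab
    have hi : g a = g b := by
      have := hf a
      rw [hab, hf b, Option.some_inj] at this
      exact this.symm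
    exact Subtype.ext ((hg a).unique (hi ▸ hg b))
  obtain ⟨a, ha⟩ := Finite.surjective_of_injective hinj ⟨j, c, h, not_lt.1 hlt⟩
  have hc := hf a
  rw [ha] at hc
  have hgc : g a = c := by
    rw [h, Option.some_inj] at hc
    exact hc.symm
  obtain ⟨k, -, hk, -⟩ := hg a
  exact hk.1 hgc

/-! ### The expected number of jobs on the list of `c` that ask `c` -/

theorem asked_congr {M M' : Market n m d} {c : Fin m} {t : ℕ}
    (h : ∀ s ≤ asked M c t, ∀ i j, Holds M' c s i j ↔ Holds M c s i j) :
    ∀ t' ≤ t, asked M' c t' = asked M c t' := by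
  intro t'
  induction t' with
  | zero => exact fun _ => rfl
  | succ t' ih =>
    intro ht'
    have ih := ih (by omega)
    have hF : freeJobs M' c (asked M c t') = freeJobs M c (asked M c t') := by
      ext j
      simp only [mem_freeJobs, h _ (asked_mono M c (by omega : t' ≤ t))]
    simp only [asked, ih, hF]

/-- At step `t`, job `j` asks candidate `i`. -/
def AsksAt (M : Market n m d) (c : Fin m) (t : ℕ) (j : Fin n) (i : Fin m) : Prop :=
  asked M c t j = (M.2 j i : ℕ) ∧ asked M c (t + 1) j = (M.2 j i : ℕ) + 1

theorem exists_asksAt {M : Market n m d} {c : Fin m} {j : Fin n} {i : Fin m} {T : ℕ}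
    (h : (M.2 j i : ℕ) < asked M c T j) : ∃ t < T, AsksAt M c t j i := by
  induction T with
  | zero => exact absurd h (Nat.not_lt_zero _)
  | succ T ih =>
    by_cases hT : (M.2 j i : ℕ) < asked M c T j
    · obtain ⟨t, ht, hA⟩ := ih hT
      exact ⟨t, by omega, hA⟩
    · have hle : asked M c (T + 1) j ≤ asked M c T j + 1 := by
        rcases advance_cases (freeJobs M c (asked M c T)) (asked M c T) with ⟨-, h⟩ | ⟨j', -, h⟩
        · exact ((congrFun h j).trans_le (Nat.le_succ _))
        · refine (congrFun h j).trans_le ?_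
          by_cases hj : j = j'
          · subst hj; rw [Function.update_self]
          · rw [Function.update_of_ne hj]; exact Nat.le_succ _
      exact ⟨T, by omega, by omega, by omega⟩

theorem AsksAt.exists_free {M : Market n m d} {c : Fin m} {t : ℕ} {j : Fin n} {i : Fin m}
    (h : AsksAt M c t j i) : j ∈ freeJobs M c (asked M c t) ∧
      asked M c (t + 1) = Function.update (asked M c t) j (asked M c t j + 1) := by
  obtain ⟨h1, h2⟩ := h
  rcases advance_cases (freeJobs M c (asked M c t)) (asked M c t) with ⟨-, h⟩ | ⟨j', hj', h⟩
  · have := congrFun h j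
    change asked M c (t + 1) j = _ at this
    omega
  · by_cases hj : j = j'
    · subst hj; exact ⟨hj', h⟩
    · have := (congrFun h j).trans (Function.update_of_ne hj _ _)
      change asked M c (t + 1) j = _ at this
      omega

theorem AsksAt.job_unique {M : Market n m d} {c : Fin m} {t : ℕ} {j j' : Fin n} {i i' : Fin m}
    (h : AsksAt M c t j i) (h' : AsksAt M c t j' i') : j = j' := by
  by_contra hne
  have h1 := congrFun h.exists_free.2 j'
  rw [Function.update_of_ne (Ne.symm hne)] at h1
  have h2 := h'.1
  have h3 := h'.2
  omega

theorem fresh_nonempty_of_asksAt {M : Market n m d} {c : Fin m} {t : ℕ} {j : Fin n} {i : Fin m}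
    (hnm : n < m) (h : AsksAt M c t j i) : (fresh M c (asked M c t)).Nonempty := by
  -- The asking job is not held, so that at most `n - 1` candidates hold jobs.
  have h1 := card_le_card_fresh_add M c t (F := Finset.univ.erase j) fun i' j' hh =>
    Finset.mem_erase.2 ⟨by
      rintro rfl
      exact (mem_freeJobs.1 h.exists_free.1).1 i' hh, Finset.mem_univ _⟩
  rw [Finset.card_erase_of_mem (Finset.mem_univ _), Finset.card_univ, Fintype.card_fin] at h1
  have := j.pos
  exact Finset.card_pos.1 (by omega)

/-- Let `a` and `b` have the jobs `j` and `x` in position `k` of their lists. In the new market, job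
`j` has `a` and `b` exchanged in its ranking, and both candidates have `j` and `x` exchanged on
their lists (if a list contains only one of these jobs, it is replaced by the other one). -/
def exchange (a b : Fin m) (k : Fin d) (M : Market n m d) : Market n m d :=
  (fun i => if i = a ∨ i = b then
      (M.1 i).trans (Equiv.swap (M.1 a k) (M.1 b k)).toEmbedding else M.1 i,
    Function.update M.2 (M.1 a k) ((Equiv.swap a b).trans (M.2 (M.1 a k))))

theorem exchange_list (a b : Fin m) (k : Fin d) (M : Market n m d) {i : Fin m}
    (h : i = a ∨ i = b) (k' : Fin d) :
    (exchange a b k M).1 i k' = Equiv.swap (M.1 a k) (M.1 b k) (M.1 i k') := by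
  simp [exchange, h]

theorem exchange_list_of_ne (a b : Fin m) (k : Fin d) (M : Market n m d) {i : Fin m}
    (ha : i ≠ a) (hb : i ≠ b) : (exchange a b k M).1 i = M.1 i := by
  simp [exchange, ha, hb]

theorem exchange_ranking (a b : Fin m) (k : Fin d) (M : Market n m d) :
    (exchange a b k M).2 (M.1 a k) = (Equiv.swap a b).trans (M.2 (M.1 a k)) := by
  simp [exchange]

theorem exchange_ranking_of_ne (a b : Fin m) (k : Fin d) (M : Market n m d) {j : Fin n}
    (h : j ≠ M.1 a k) : (exchange a b k M).2 j = M.2 j := by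
  simp [exchange, h]

theorem exchange_exchange (a b : Fin m) (k : Fin d) (M : Market n m d) :
    exchange b a k (exchange a b k M) = M := by
  have h1 : (exchange a b k M).1 b k = M.1 a k := by
    rw [exchange_list _ _ _ _ (Or.inr rfl), Equiv.swap_apply_right]
  have h2 : (exchange a b k M).1 a k = M.1 b k := by
    rw [exchange_list _ _ _ _ (Or.inl rfl), Equiv.swap_apply_left]
  refine Prod.ext (funext fun i => ?_) (funext fun j => ?_)
  · by_cases hi : i = b ∨ i = a
    · ext k'
      rw [exchange_list _ _ _ _ hi, h1, h2, exchange_list _ _ _ _ hi.symm, Equiv.swap_apply_self]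
    · rw [not_or] at hi
      rw [exchange_list_of_ne _ _ _ _ hi.1 hi.2, exchange_list_of_ne _ _ _ _ hi.2 hi.1]
  · by_cases hj : j = M.1 a k
    · subst hj
      conv_lhs => rw [← h1, exchange_ranking, h1, exchange_ranking]
      ext i
      simp [Equiv.swap_comm b a]
    · rw [exchange_ranking_of_ne _ _ _ _ (h1.symm ▸ hj), exchange_ranking_of_ne _ _ _ _ hj]

/-- If `b` is fresh when the job `j` in position `k` of the list of `c` asks `c`, then the process
runs in the same way up to this point if `b` and `c` are exchanged. -/
theorem holds_exchange {M : Market n m d} {c b : Fin m} {t : ℕ} {k : Fin d}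
    (hA : AsksAt M c t (M.1 c k) c) (hb : b ∈ fresh M c (asked M c t))
    {s : Fin n → ℕ} (hs : s ≤ asked M c t) :
    (∀ i j, Holds (exchange c b k M) c s i j ↔ Holds M c s i j) ∧
      fresh (exchange c b k M) c s = fresh M c s := by
  obtain ⟨hbc, hb⟩ := mem_fresh.1 hb
  have hlt : ∀ k', asked M c t (M.1 b k') ≤ M.2 (M.1 b k') b := fun k' =>
    not_lt.1 fun h => hb k' ⟨hbc, h⟩
  have hnot : ∀ k', ¬ Reached M c s b k' := fun k' h => hb k' (h.mono hs)
  have hnot' : ∀ k', ¬ Reached (exchange c b k M) c s b k' := by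
    rintro k' ⟨-, h⟩
    rw [exchange_list _ _ _ _ (Or.inr rfl)] at h
    set y := Equiv.swap (M.1 c k) (M.1 b k) (M.1 b k') with hy
    have hsy : s y ≤ asked M c t y := hs y
    by_cases hyj : y = M.1 c k
    · rw [hyj, exchange_ranking] at h
      simp only [Equiv.trans_apply, Equiv.swap_apply_right] at h
      rw [← hA.1, ← hyj] at h
      omega
    · -- The new list of `b` contains no new job apart from the one that asks `c`.
      obtain ⟨k'', hk''⟩ : ∃ k'', y = M.1 b k'' := by
        rw [hy]
        by_cases h1 : M.1 b k' = M.1 c k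
        · exact ⟨k, by rw [h1, Equiv.swap_apply_left]⟩
        · by_cases h2 : M.1 b k' = M.1 b k
          · exact absurd (by rw [hy, h2, Equiv.swap_apply_right]) hyj
          · exact ⟨k', Equiv.swap_apply_of_ne_of_ne h1 h2⟩
      rw [exchange_ranking_of_ne _ _ _ _ hyj] at h
      have := hlt k''
      rw [← hk''] at this
      omega
  have hlist : ∀ i, i ≠ c → i ≠ b → (exchange c b k M).1 i = M.1 i := fun i h1 h2 =>
    exchange_list_of_ne _ _ _ _ h1 h2
  have hreach : ∀ i k', Reached (exchange c b k M) c s i k' ↔ Reached M c s i k' := by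
    intro i k'
    by_cases hic : i = c
    · exact iff_of_false (fun h => h.1 hic) (fun h => h.1 hic)
    by_cases hib : i = b
    · subst hib
      exact iff_of_false (hnot' k') (hnot k')
    have hrank : (exchange c b k M).2 (M.1 i k') i = M.2 (M.1 i k') i := by
      by_cases hj : M.1 i k' = M.1 c k
      · rw [hj, exchange_ranking, Equiv.trans_apply, Equiv.swap_apply_of_ne_of_ne hic hib]
      · rw [exchange_ranking_of_ne _ _ _ _ hj]
    simp only [Reached, hlist i hic hib, hrank]
  refine ⟨fun i j => ?_, ?_⟩
  · by_cases hi : i = c ∨ i = b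
    · refine iff_of_false ?_ ?_
      · rintro ⟨k', -, hr, -⟩
        rcases hi with rfl | rfl
        exacts [hr.1 rfl, hnot' _ hr]
      · rintro ⟨k', -, hr, -⟩
        rcases hi with rfl | rfl
        exacts [hr.1 rfl, hnot _ hr]
    · rw [not_or] at hi
      simp only [Holds, hreach, hlist i hi.1 hi.2]
  · ext i
    simp only [mem_fresh, hreach]

theorem asksAt_exchange {M : Market n m d} {c b : Fin m} {t : ℕ} {k : Fin d}
    (hA : AsksAt M c t (M.1 c k) c) (hb : b ∈ fresh M c (asked M c t)) :
    AsksAt (exchange c b k M) c t ((exchange c b k M).1 b k) b ∧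
      fresh (exchange c b k M) c (asked (exchange c b k M) c t) = fresh M c (asked M c t) := by
  have h1 : (exchange c b k M).1 b k = M.1 c k := by
    rw [exchange_list _ _ _ _ (Or.inr rfl), Equiv.swap_apply_right]
  have h2 : (exchange c b k M).2 (M.1 c k) b = M.2 (M.1 c k) c := by
    rw [exchange_ranking, Equiv.trans_apply, Equiv.swap_apply_right]
  have h3 : asked (exchange c b k M) c t = asked M c t :=
    asked_congr (fun s hs => (holds_exchange hA hb hs).1) t le_rfl
  have h4 : freeJobs (exchange c b k M) c (asked M c t) = freeJobs M c (asked M c t) := by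
    ext j
    simp only [mem_freeJobs, (holds_exchange hA hb le_rfl).1]
  refine ⟨?_, by rw [h3, (holds_exchange hA hb le_rfl).2]⟩
  rw [h1]
  have h5 : asked (exchange c b k M) c (t + 1) = asked M c (t + 1) := by
    simp only [asked, h3, h4]
  unfold AsksAt
  rw [h2, h3, h5]
  exact hA

theorem sub_div_le_harmonic_sub {u v : ℕ} (h : u ≤ v) :
    ((v : ℝ) - u) / v ≤ (harmonic v : ℝ) - harmonic u := by
  rcases Nat.eq_zero_or_pos v with rfl | hv
  · obtain rfl : u = 0 := by omega
    simp
  have hv' : (0 : ℝ) < v := by exact_mod_cast hv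
  have key : ∀ w, u + w ≤ v → (w : ℝ) / v ≤ (harmonic (u + w) : ℝ) - harmonic u := by
    intro w
    induction w with
    | zero => simp
    | succ w ih =>
      intro hw
      have ih := ih (by omega)
      have h1 : (1 : ℝ) / v ≤ ((u + w + 1 : ℕ) : ℝ)⁻¹ := by
        rw [one_div]
        exact inv_anti₀ (by positivity) (by exact_mod_cast hw)
      rw [← add_assoc, harmonic_succ]
      push_cast at h1 ⊢
      rw [add_div]
      linarith
  have := key (v - u) (by omega)
  rwa [Nat.add_sub_cancel' h, Nat.cast_sub h] at this

theorem harmonic_mono : Monotone fun u => (harmonic u : ℝ) :=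
  monotone_nat_of_le_succ fun u => by
    simp only [harmonic_succ]
    push_cast
    have : (0 : ℝ) ≤ ((u : ℝ) + 1)⁻¹ := by positivity
    linarith

open Classical in
/-- A coupon collector bound: each time a fresh candidate is asked by a job on its list, the number
of fresh candidates decreases. It is `m - 1` at the start and at least `m - 1 - n` at the end. -/
theorem sum_fresh_asked_le (M : Market n m d) (c : Fin m) (T : ℕ) :
    ∑ t ∈ Finset.range T, ∑ k : Fin d, ∑ i : Fin m,
      (if AsksAt M c t (M.1 i k) i ∧ i ∈ fresh M c (asked M c t) then
        1 / ((fresh M c (asked M c t)).card : ℝ) else 0) ≤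
      (harmonic (m - 1) : ℝ) - harmonic (m - 1 - n) := by
  have hstep : ∀ t, ∑ k : Fin d, ∑ i : Fin m,
      (if AsksAt M c t (M.1 i k) i ∧ i ∈ fresh M c (asked M c t) then
        1 / ((fresh M c (asked M c t)).card : ℝ) else 0) ≤
      (harmonic (fresh M c (asked M c t)).card : ℝ) -
        harmonic (fresh M c (asked M c (t + 1))).card := by
    intro t
    have hsub := fresh_anti M c (asked_mono M c t.le_succ)
    refine le_trans ?_ (sub_div_le_harmonic_sub (Finset.card_le_card hsub))
    set u : ℝ := ((fresh M c (asked M c t)).card : ℝ)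
    have hinner : ∀ i : Fin m, ∑ k : Fin d,
        (if AsksAt M c t (M.1 i k) i ∧ i ∈ fresh M c (asked M c t) then 1 / u else 0) ≤
        if i ∈ fresh M c (asked M c t) \ fresh M c (asked M c (t + 1)) then 1 / u else 0 := by
      intro i
      by_cases hex : ∃ k, AsksAt M c t (M.1 i k) i ∧ i ∈ fresh M c (asked M c t)
      · obtain ⟨k, hA, hi⟩ := hex
        have hi' : i ∉ fresh M c (asked M c (t + 1)) := fun h =>
          (mem_fresh.1 h).2 k ⟨(mem_fresh.1 h).1, by rw [hA.2]; exact Nat.lt_succ_self _⟩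
        rw [if_pos (Finset.mem_sdiff.2 ⟨hi, hi'⟩), Finset.sum_eq_single k]
        · rw [if_pos ⟨hA, hi⟩]
        · intro k' _ hk'
          rw [if_neg]
          rintro ⟨hA', -⟩
          exact hk' ((M.1 i).injective (hA'.job_unique hA))
        · simp
      · rw [not_exists] at hex
        simp only [if_neg (hex _), Finset.sum_const_zero]
        split_ifs <;> positivity
    rw [Finset.sum_comm]
    refine (Finset.sum_le_sum fun i _ => hinner i).trans (le_of_eq ?_)
    rw [← Finset.sum_filter, Finset.filter_mem_eq_inter, Finset.univ_inter, Finset.sum_const,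
      Finset.card_sdiff_of_subset hsub, nsmul_eq_mul, Nat.cast_sub (Finset.card_le_card hsub)]
    ring
  refine (Finset.sum_le_sum fun t _ => hstep t).trans ?_
  rw [Finset.sum_range_sub' (fun t => (harmonic (fresh M c (asked M c t)).card : ℝ))]
  have h0 : (fresh M c (asked M c 0)).card ≤ m - 1 := by
    have : fresh M c (asked M c 0) ⊆ Finset.univ.erase c := fun i hi =>
      Finset.mem_erase.2 ⟨(mem_fresh.1 hi).1, Finset.mem_univ _⟩
    simpa using Finset.card_le_card this
  have hT : m - 1 - n ≤ (fresh M c (asked M c T)).card := by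
    have := card_le_card_fresh_add M c T (F := Finset.univ) fun _ _ _ => Finset.mem_univ _
    rw [Finset.card_univ, Fintype.card_fin] at this
    omega
  exact sub_le_sub (harmonic_mono h0) (harmonic_mono hT)

/-- The positions on the list of `c` of the jobs that ask `c`. -/
noncomputable def hits (M : Market n m d) (c : Fin m) : Finset (Fin d) :=
  Finset.univ.filter fun k => (M.2 (M.1 c k) c : ℕ) < finalAsked M c (M.1 c k)

/-- When a job asks `c`, the exchange of `c` with a fresh candidate turns this into an event in
which that candidate gets a first offer. So the number of jobs on the list of `c` that ask `c` is
in expectation at most the sum in the coupon collector bound. -/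
theorem sum_card_hits_le (hnm : n < m) (c : Fin m) :
    ∑ M : Market n m d, ((hits M c).card : ℝ) ≤
      (Fintype.card (Market n m d) : ℝ) * ((harmonic (m - 1) : ℝ) - harmonic (m - 1 - n)) := by
  classical
  set T := n * m
  have h1 : ∀ M : Market n m d, ((hits M c).card : ℝ) ≤
      ∑ t ∈ Finset.range T, ∑ k : Fin d, ∑ i : Fin m,
        (if AsksAt M c t (M.1 c k) c ∧ i ∈ fresh M c (asked M c t) then
          1 / ((fresh M c (asked M c t)).card : ℝ) else 0) := by
    intro M
    have hval : ∀ t (k : Fin d), ∑ i : Fin m,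
        (if AsksAt M c t (M.1 c k) c ∧ i ∈ fresh M c (asked M c t) then
          1 / ((fresh M c (asked M c t)).card : ℝ) else 0) =
        if AsksAt M c t (M.1 c k) c then 1 else 0 := by
      intro t k
      by_cases hA : AsksAt M c t (M.1 c k) c
      · have hpos : ((fresh M c (asked M c t)).card : ℝ) ≠ 0 :=
          Nat.cast_ne_zero.2 (fresh_nonempty_of_asksAt hnm hA).card_ne_zero
        simp only [hA, true_and, if_true]
        rw [← Finset.sum_filter, Finset.filter_mem_eq_inter, Finset.univ_inter, Finset.sum_const,
          nsmul_eq_mul, mul_one_div_cancel hpos]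
      · simp [hA]
    simp only [hval]
    rw [Finset.sum_comm]
    have hcard : ((hits M c).card : ℝ) = ∑ k : Fin d, if k ∈ hits M c then 1 else 0 := by
      simp
    rw [hcard]
    refine Finset.sum_le_sum fun k _ => ?_
    by_cases hk : k ∈ hits M c
    · obtain ⟨t, ht, hA⟩ := exists_asksAt (Finset.mem_filter.1 hk).2
      rw [if_pos hk]
      refine le_trans ?_ (Finset.single_le_sum
        (f := fun t => if AsksAt M c t (M.1 c k) c then (1 : ℝ) else 0)
        (fun t _ => by split_ifs <;> norm_num) (Finset.mem_range.2 ht))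
      simp [hA]
    · rw [if_neg hk]
      exact Finset.sum_nonneg fun t _ => by split_ifs <;> norm_num
  have h2 : ∀ (t : ℕ) (k : Fin d) (i : Fin m),
      ∑ M : Market n m d, (if AsksAt M c t (M.1 c k) c ∧ i ∈ fresh M c (asked M c t) then
          1 / ((fresh M c (asked M c t)).card : ℝ) else 0) ≤
      ∑ M : Market n m d, (if AsksAt M c t (M.1 i k) i ∧ i ∈ fresh M c (asked M c t) then
          1 / ((fresh M c (asked M c t)).card : ℝ) else 0) := by
    intro t k i
    rw [← Finset.sum_filter, ← Finset.sum_filter]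
    have hinj : Function.Injective (exchange c i k : Market n m d → Market n m d) :=
      Function.LeftInverse.injective (g := exchange i c k) fun M => exchange_exchange c i k M
    calc _ = ∑ M ∈ (Finset.univ.filter fun M : Market n m d =>
            AsksAt M c t (M.1 c k) c ∧ i ∈ fresh M c (asked M c t)).image (exchange c i k),
            1 / ((fresh M c (asked M c t)).card : ℝ) := by
          rw [Finset.sum_image hinj.injOn]
          refine Finset.sum_congr rfl fun M hM => ?_
          obtain ⟨hA, hi⟩ := (Finset.mem_filter.1 hM).2
          rw [(asksAt_exchange hA hi).2]
      _ ≤ _ := by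
          refine Finset.sum_le_sum_of_subset_of_nonneg ?_ fun _ _ _ => by positivity
          intro M' hM'
          obtain ⟨M, hM, rfl⟩ := Finset.mem_image.1 hM'
          obtain ⟨hA, hi⟩ := (Finset.mem_filter.1 hM).2
          obtain ⟨hA', hf⟩ := asksAt_exchange hA hi
          exact Finset.mem_filter.2 ⟨Finset.mem_univ _, hA', hf ▸ hi⟩
  calc ∑ M : Market n m d, ((hits M c).card : ℝ)
      ≤ ∑ M : Market n m d, ∑ t ∈ Finset.range T, ∑ k : Fin d, ∑ i : Fin m,
        (if AsksAt M c t (M.1 c k) c ∧ i ∈ fresh M c (asked M c t) then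
          1 / ((fresh M c (asked M c t)).card : ℝ) else 0) := Finset.sum_le_sum fun M _ => h1 M
    _ = ∑ t ∈ Finset.range T, ∑ k : Fin d, ∑ i : Fin m, ∑ M : Market n m d,
        (if AsksAt M c t (M.1 c k) c ∧ i ∈ fresh M c (asked M c t) then
          1 / ((fresh M c (asked M c t)).card : ℝ) else 0) := by
        rw [Finset.sum_comm]
        refine Finset.sum_congr rfl fun t _ => ?_
        rw [Finset.sum_comm]
        exact Finset.sum_congr rfl fun k _ => Finset.sum_comm
    _ ≤ ∑ t ∈ Finset.range T, ∑ k : Fin d, ∑ i : Fin m, ∑ M : Market n m d,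
        (if AsksAt M c t (M.1 i k) i ∧ i ∈ fresh M c (asked M c t) then
          1 / ((fresh M c (asked M c t)).card : ℝ) else 0) :=
        Finset.sum_le_sum fun t _ => Finset.sum_le_sum fun k _ => Finset.sum_le_sum fun i _ =>
          h2 t k i
    _ = ∑ M : Market n m d, ∑ t ∈ Finset.range T, ∑ k : Fin d, ∑ i : Fin m,
        (if AsksAt M c t (M.1 i k) i ∧ i ∈ fresh M c (asked M c t) then
          1 / ((fresh M c (asked M c t)).card : ℝ) else 0) := by
        symm
        rw [Finset.sum_comm]
        refine Finset.sum_congr rfl fun t _ => ?_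
        rw [Finset.sum_comm]
        exact Finset.sum_congr rfl fun k _ => Finset.sum_comm
    _ ≤ ∑ _M : Market n m d, ((harmonic (m - 1) : ℝ) - harmonic (m - 1 - n)) :=
        Finset.sum_le_sum fun M _ => sum_fresh_asked_le M c T
    _ = _ := by
        rw [Finset.sum_const, Finset.card_univ, nsmul_eq_mul]

/-! ### From asking jobs to ranks -/

theorem card_leading_le_candidateRank (M : Market n m d) (c : Fin m) :
    (Finset.univ.filter fun k : Fin d => ∀ k' < k, k' ∉ hits M c).card ≤ candidateRank M c := by
  unfold candidateRank
  split_ifs with h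
  · have hs := Fin.find_spec h
    set k₀ := Fin.find _ h
    have hk₀ : k₀ ∈ hits M c := Finset.mem_filter.2 ⟨Finset.mem_univ _, asked_of_cpda_held hs⟩
    have : (Finset.univ.filter fun k : Fin d => ∀ k' < k, k' ∉ hits M c) ⊆ Finset.Iic k₀ :=
      fun k hk => Finset.mem_Iic.2 (not_lt.1 fun hlt => (Finset.mem_filter.1 hk).2 k₀ hlt hk₀)
    simpa using Finset.card_le_card this
  · simpa using Finset.card_le_univ (Finset.univ.filter fun k : Fin d => ∀ k' < k, k' ∉ hits M c)

/-- In a random order, each element `x` precedes all elements of `H` other than `x` with probability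
at least `1 / (#H + 1)`, so that on average at least `d / (#H + 1)` elements do so. -/
theorem le_sum_perm_card_leading (H : Finset (Fin d)) :
    (d.factorial : ℝ) * (d / ((H.card : ℝ) + 1)) ≤ ∑ π : Equiv.Perm (Fin d),
      ((Finset.univ.filter fun k : Fin d => ∀ k' < k, π k' ∉ H).card : ℝ) := by
  classical
  have hfirst : ∀ x : Fin d, (d.factorial : ℝ) / ((H.card : ℝ) + 1) ≤
      ((Finset.univ.filter fun π : Equiv.Perm (Fin d) => ∀ y ∈ H, π.symm x ≤ π.symm y).card : ℝ) := by
    intro x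
    have hcov : (Finset.univ : Finset (Equiv.Perm (Fin d))) ⊆
        (insert x H).biUnion fun z => Finset.univ.filter fun π : Equiv.Perm (Fin d) =>
          ∀ y ∈ insert x H, π.symm z ≤ π.symm y := by
      intro π _
      obtain ⟨z, hz, hmin⟩ := Finset.exists_min_image (insert x H) (fun z => π.symm z)
        (Finset.insert_nonempty x H)
      exact Finset.mem_biUnion.2 ⟨z, hz, Finset.mem_filter.2 ⟨Finset.mem_univ _, hmin⟩⟩
    have hle : ∀ z ∈ insert x H, (Finset.univ.filter fun π : Equiv.Perm (Fin d) =>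
          ∀ y ∈ insert x H, π.symm z ≤ π.symm y).card ≤
        (Finset.univ.filter fun π : Equiv.Perm (Fin d) => ∀ y ∈ H, π.symm x ≤ π.symm y).card := by
      intro z hz
      refine Finset.card_le_card_of_injOn (fun π => π.trans (Equiv.swap x z)) ?_
        (fun π _ π' _ h => Equiv.ext fun k => (Equiv.swap x z).injective (Equiv.congr_fun h k))
      intro π hπ
      have hπ := (Finset.mem_filter.1 hπ).2
      refine Finset.mem_coe.2 (Finset.mem_filter.2 ⟨Finset.mem_univ _, fun y hy => ?_⟩)
      simp only [Equiv.symm_trans_apply, Equiv.symm_swap, Equiv.swap_apply_left]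
      refine hπ _ ?_
      by_cases hyx : y = x
      · rw [hyx, Equiv.swap_apply_left]; exact hz
      by_cases hyz : y = z
      · rw [hyz, Equiv.swap_apply_right]; exact Finset.mem_insert_self _ _
      · rw [Equiv.swap_apply_of_ne_of_ne hyx hyz]; exact Finset.mem_insert_of_mem hy
    have h1 := (Finset.card_le_card hcov).trans
      (Finset.card_biUnion_le_card_mul _ _ _ hle)
    rw [Finset.card_univ, Fintype.card_perm, Fintype.card_fin] at h1
    have h2 := h1.trans (Nat.mul_le_mul_right _ (Finset.card_insert_le x H))
    rw [div_le_iff₀ (by positivity), mul_comm]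
    exact_mod_cast h2
  have hcount : ∀ π : Equiv.Perm (Fin d),
      (Finset.univ.filter fun k : Fin d => ∀ k' < k, π k' ∉ H).card =
        ∑ x : Fin d, if ∀ y ∈ H, π.symm x ≤ π.symm y then 1 else 0 := by
    intro π
    rw [Finset.card_filter, ← Equiv.sum_comp π.symm]
    refine Finset.sum_congr rfl fun x _ => ?_
    refine if_congr ⟨fun h y hy => ?_, fun h k' hk' hmem => ?_⟩ rfl rfl
    · exact not_lt.1 fun hlt => h _ hlt (by rwa [Equiv.apply_symm_apply])
    · exact absurd (h _ hmem) (by rw [Equiv.symm_apply_apply]; exact not_le.2 hk')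
  simp only [hcount]
  push_cast
  rw [Finset.sum_comm]
  calc (d.factorial : ℝ) * (d / ((H.card : ℝ) + 1))
      = ∑ _x : Fin d, (d.factorial : ℝ) / ((H.card : ℝ) + 1) := by
        rw [Finset.sum_const, Finset.card_univ, Fintype.card_fin, nsmul_eq_mul]; ring
    _ ≤ _ := Finset.sum_le_sum fun x _ => (hfirst x).trans (le_of_eq (by simp))

/-- The list of `c` is put into a new order. -/
def reorder (c : Fin m) (π : Equiv.Perm (Fin d)) (M : Market n m d) : Market n m d :=
  (Function.update M.1 c (π.toEmbedding.trans (M.1 c)), M.2)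

theorem reorder_injective (c : Fin m) (π : Equiv.Perm (Fin d)) :
    Function.Injective (reorder c π : Market n m d → Market n m d) := by
  refine Function.LeftInverse.injective (g := reorder c π.symm) fun M => ?_
  refine Prod.ext ?_ rfl
  simp only [reorder, Function.update_idem, Function.update_self]
  refine (Function.update_eq_self_iff).2 ?_
  ext k
  simp

theorem mem_hits_reorder (c : Fin m) (π : Equiv.Perm (Fin d)) (M : Market n m d) (k : Fin d) :
    k ∈ hits (reorder c π M) c ↔ π k ∈ hits M c := by
  have hreach : ∀ s i k', Reached (reorder c π M) c s i k' ↔ Reached M c s i k' := by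
    intro s i k'
    by_cases hi : i = c
    · exact iff_of_false (fun h => h.1 hi) (fun h => h.1 hi)
    · simp [Reached, reorder, hi]
  have hholds : ∀ s i j, Holds (reorder c π M) c s i j ↔ Holds M c s i j := by
    intro s i j
    by_cases hi : i = c
    · refine iff_of_false ?_ ?_ <;> rintro ⟨k', -, hr, -⟩ <;> exact hr.1 hi
    · simp only [Holds, hreach]
      simp [reorder, hi]
  have hfin : finalAsked (reorder c π M) c = finalAsked M c :=
    asked_congr (fun s _ => hholds s) _ le_rfl
  simp only [hits, Finset.mem_filter, Finset.mem_univ, true_and, hfin]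
  simp [reorder]

/-- The expected rank is at least `d / (1 + h)` where the difference `h` of harmonic numbers bounds
the expected number of jobs on the list of `c` that ask `c`. -/
theorem div_one_add_harmonic_sub_le_expectedRank (hnm : n < m) (hd : d ≤ n) (c : Fin m) :
    (d : ℝ) / (1 + ((harmonic (m - 1) : ℝ) - harmonic (m - 1 - n))) ≤ expectedRank n m d c := by
  classical
  set h : ℝ := (harmonic (m - 1) : ℝ) - harmonic (m - 1 - n)
  have hh0 : 0 ≤ h := sub_nonneg.2 (harmonic_mono (Nat.sub_le _ _))
  have hcard : 0 < (Fintype.card (Market n m d) : ℝ) := by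
    have : Nonempty (Fin d ↪ Fin n) := ⟨Fin.castLEEmb hd⟩
    exact Nat.cast_pos.2 Fintype.card_pos
  set f : Market n m d → ℝ := fun M =>
    ((Finset.univ.filter fun k : Fin d => ∀ k' < k, k' ∉ hits M c).card : ℝ) with hf
  -- The average of `f` over the orders of the list of `c`.
  have h1 : ∑ M : Market n m d, (d : ℝ) / (((hits M c).card : ℝ) + 1) ≤ ∑ M, f M := by
    have hfac : (0 : ℝ) < d.factorial := Nat.cast_pos.2 d.factorial_pos
    refine le_of_mul_le_mul_left ?_ hfac
    calc (d.factorial : ℝ) * ∑ M : Market n m d, (d : ℝ) / (((hits M c).card : ℝ) + 1)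
        ≤ ∑ M : Market n m d, ∑ π : Equiv.Perm (Fin d), f (reorder c π M) := by
          rw [Finset.mul_sum]
          refine Finset.sum_le_sum fun M _ => (le_sum_perm_card_leading (hits M c)).trans ?_
          simp only [hf, mem_hits_reorder]
          exact le_rfl
      _ = ∑ π : Equiv.Perm (Fin d), ∑ M : Market n m d, f (reorder c π M) := Finset.sum_comm
      _ = ∑ _π : Equiv.Perm (Fin d), ∑ M : Market n m d, f M := by
          refine Finset.sum_congr rfl fun π _ => ?_
          exact Function.Bijective.sum_comp
            (Finite.injective_iff_bijective.1 (reorder_injective c π)) f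
      _ = _ := by
          rw [Finset.sum_const, Finset.card_univ, Fintype.card_perm, Fintype.card_fin,
            nsmul_eq_mul]
  -- Jensen's inequality for `1 / (1 + y)`, with the tangent at `h`.
  have h2 : ∀ y : ℝ, 0 ≤ y → 1 / (1 + h) - (y - h) / (1 + h) ^ 2 ≤ 1 / (y + 1) := by
    intro y hy
    have : 1 / (y + 1) - (1 / (1 + h) - (y - h) / (1 + h) ^ 2) =
        (y - h) ^ 2 / ((y + 1) * (1 + h) ^ 2) := by
      field_simp
      ring
    have h3 : 0 ≤ (y - h) ^ 2 / ((y + 1) * (1 + h) ^ 2) := by positivity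
    linarith
  have h3 : ∑ M : Market n m d, (((hits M c).card : ℝ) - h) ≤ 0 := by
    rw [Finset.sum_sub_distrib, Finset.sum_const, Finset.card_univ, nsmul_eq_mul, sub_nonpos]
    exact sum_card_hits_le hnm c
  rw [expectedRank, le_div_iff₀ hcard]
  calc (d : ℝ) / (1 + h) * (Fintype.card (Market n m d) : ℝ)
      ≤ d * (∑ _M : Market n m d, 1 / (1 + h) -
          (∑ M : Market n m d, (((hits M c).card : ℝ) - h)) / (1 + h) ^ 2) := by
        have : (∑ M : Market n m d, (((hits M c).card : ℝ) - h)) / (1 + h) ^ 2 ≤ 0 :=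
          div_nonpos_of_nonpos_of_nonneg h3 (by positivity)
        rw [Finset.sum_const, Finset.card_univ, nsmul_eq_mul]
        calc (d : ℝ) / (1 + h) * (Fintype.card (Market n m d) : ℝ)
            = d * ((Fintype.card (Market n m d) : ℝ) * (1 / (1 + h))) := by ring
          _ ≤ _ := mul_le_mul_of_nonneg_left (by linarith) (Nat.cast_nonneg _)
    _ = ∑ M : Market n m d,
          d * (1 / (1 + h) - (((hits M c).card : ℝ) - h) / (1 + h) ^ 2) := by
        rw [← Finset.mul_sum, Finset.sum_div, ← Finset.sum_sub_distrib]
    _ ≤ ∑ M : Market n m d, (d : ℝ) / (((hits M c).card : ℝ) + 1) := by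
        refine Finset.sum_le_sum fun M _ => ?_
        rw [div_eq_mul_one_div (d : ℝ)]
        exact mul_le_mul_of_nonneg_left (h2 _ (Nat.cast_nonneg _)) (Nat.cast_nonneg _)
    _ ≤ ∑ M, f M := h1
    _ ≤ ∑ M : Market n m d, (candidateRank M c : ℝ) :=
        Finset.sum_le_sum fun M _ => Nat.cast_le.2 (card_leading_le_candidateRank M c)

/-! ### Asymptotics -/

theorem harmonic_sub_le_log {u v : ℕ} (h : u < v) :
    (harmonic v : ℝ) - harmonic u ≤ 1 + Real.log (v / (u + 1)) := by
  obtain ⟨w, rfl⟩ : ∃ w, v = u + 1 + w := ⟨v - (u + 1), by omega⟩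
  clear h
  have hu : (0 : ℝ) < (u : ℝ) + 1 := by positivity
  induction w with
  | zero =>
    simp only [add_zero, harmonic_succ]
    push_cast
    rw [div_self hu.ne', Real.log_one]
    have : ((u : ℝ) + 1)⁻¹ ≤ 1 := inv_le_one_of_one_le₀ (by linarith [u.cast_nonneg (α := ℝ)])
    linarith
  | succ w ih =>
    rw [← add_assoc, harmonic_succ]
    set v := u + 1 + w with hv
    have hv0 : (0 : ℝ) < v := by rw [hv]; positivity
    push_cast
    rw [Real.log_div hv0.ne' hu.ne'] at ih
    rw [Real.log_div (by positivity) hu.ne']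
    have hlog : ((v : ℝ) + 1)⁻¹ ≤ Real.log (v + 1) - Real.log v := by
      have := Real.one_sub_inv_le_log_of_pos (x := ((v : ℝ) + 1) / v) (by positivity)
      rw [Real.log_div (by positivity) hv0.ne'] at this
      refine le_trans (le_of_eq ?_) this
      field_simp
      ring
    linarith

theorem tendsto_log_atTop {α : ℕ → ℝ} (hα_pos : ∀ᶠ n : ℕ in atTop, 0 < α n)
    (hα : Tendsto α atTop (𝓝 0)) :
    Tendsto (fun n : ℕ => Real.log ((1 + α n) / (α n + 1 / ((n : ℝ) * (1 + α n))))) atTop atTop := by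
  refine Real.tendsto_log_atTop.comp ?_
  have h1 : Tendsto (fun n => 1 + α n) atTop (𝓝 1) := by
    simpa using tendsto_const_nhds.add hα
  have h2 : Tendsto (fun n : ℕ => (n : ℝ) * (1 + α n)) atTop atTop :=
    tendsto_natCast_atTop_atTop.atTop_mul_pos one_pos h1
  have h3 : Tendsto (fun n : ℕ => α n + 1 / ((n : ℝ) * (1 + α n))) atTop (𝓝[>] 0) := by
    refine tendsto_nhdsWithin_iff.2 ⟨?_, ?_⟩
    · simpa using hα.add (h2.inv_tendsto_atTop)
    · filter_upwards [hα_pos] with n hn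
      have : 0 ≤ 1 / ((n : ℝ) * (1 + α n)) := by positivity
      exact add_pos_of_pos_of_nonneg hn this
  simpa [div_eq_mul_inv] using h1.pos_mul_atTop one_pos h3.inv_tendsto_nhdsGT_zero

/-- The harmonic numbers in the bound for the expected rank exceed the logarithm by at most a
constant. Since `m - n` is a positive integer, `1 / (n (1 + α))` is at most `α`. -/
theorem one_add_harmonic_sub_le {n m : ℕ} {α : ℝ} (hn : 1 ≤ n) (hα : 0 < α)
    (hm : (m : ℝ) = n * (1 + α)) (hnm : n < m) :
    1 + ((harmonic (m - 1) : ℝ) - harmonic (m - 1 - n)) ≤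
      3 + Real.log ((1 + α) / (α + 1 / (n * (1 + α)))) := by
  have hn0 : (0 : ℝ) < n := by exact_mod_cast hn
  have hm0 : (0 : ℝ) < m := by rw [hm]; positivity
  have h1 := harmonic_sub_le_log (show m - 1 - n < m - 1 by omega)
  have h2 : ((m - 1 - n : ℕ) : ℝ) + 1 = n * α := by
    have : m - 1 - n + 1 + n = m := by omega
    have h : ((m - 1 - n : ℕ) : ℝ) + 1 + n = m := by exact_mod_cast this
    linarith
  have h3 : 1 ≤ n * α := by
    rw [← h2]; linarith [(m - 1 - n).cast_nonneg (α := ℝ)]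
  have h4 : ((m - 1 : ℕ) : ℝ) ≤ n * (1 + α) := by
    rw [← hm]; exact_mod_cast Nat.sub_le _ _
  have h5 : (0 : ℝ) < (m - 1 : ℕ) := Nat.cast_pos.2 (by omega)
  rw [h2] at h1
  have hden : α + 1 / (n * (1 + α)) ≤ 2 * α := by
    have : 1 / (n * (1 + α)) ≤ α := by
      rw [div_le_iff₀ (by positivity)]
      nlinarith
    linarith
  have h6 : ((m - 1 : ℕ) : ℝ) / (n * α) ≤ 2 * ((1 + α) / (α + 1 / (n * (1 + α)))) := by
    calc ((m - 1 : ℕ) : ℝ) / (n * α) ≤ n * (1 + α) / (n * α) := by gcongr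
      _ = 2 * ((1 + α) / (2 * α)) := by field_simp
      _ ≤ _ := by gcongr
  have h7 := Real.log_le_log (by positivity) h6
  rw [Real.log_mul two_ne_zero (by positivity)] at h7
  linarith [Real.log_two_lt_d9]

end StableMarket

open StableMarket in
theorem theorem3 (m d : ℕ → ℕ) (α : ℕ → ℝ)
    (hm : ∀ᶠ n : ℕ in atTop, (m n : ℝ) = (n : ℝ) * (1 + α n))
    (hα_pos : ∀ᶠ n : ℕ in atTop, 0 < α n)
    (hα : Tendsto α atTop (𝓝 0))
    (hd : ∀ᶠ n : ℕ in atTop, 1 ≤ d n ∧ d n ≤ n) :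
    ∃ e : ℕ → ℝ, Tendsto e atTop (𝓝 0) ∧
      ∀ᶠ n : ℕ in atTop, ∀ c : Fin (m n),
        (1 - e n) * ((d n : ℝ) / Real.log ((1 + α n) / (α n + 1 / ((n : ℝ) * (1 + α n)))))
          ≤ StableMarket.expectedRank n (m n) (d n) c := by
  have hlim := tendsto_log_atTop hα_pos hα
  set L : ℕ → ℝ := fun n => Real.log ((1 + α n) / (α n + 1 / ((n : ℝ) * (1 + α n)))) with hL
  refine ⟨fun n => 3 / (3 + L n), ?_, ?_⟩
  · exact Tendsto.div_atTop tendsto_const_nhds (tendsto_atTop_add_const_left _ _ hlim)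
  · filter_upwards [hm, hα_pos, hd, hlim.eventually_gt_atTop 0] with n hm hα hd hLpos c
    have hn : 1 ≤ n := hd.1.trans hd.2
    have hnm : n < m n := by
      have hn0 : (0 : ℝ) < n := by exact_mod_cast hn
      have : (n : ℝ) < m n := by rw [hm]; nlinarith
      exact_mod_cast this
    have h1 := one_add_harmonic_sub_le hn hα hm hnm
    have h0 : (0 : ℝ) ≤ (harmonic (m n - 1) : ℝ) - harmonic (m n - 1 - n) :=
      sub_nonneg.2 (harmonic_mono (Nat.sub_le _ _))
    refine le_trans ?_ (div_one_add_harmonic_sub_le_expectedRank hnm hd.2 c)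
    change (1 - 3 / (3 + L n)) * ((d n : ℝ) / L n) ≤ _
    have hLn : 0 < L n := hLpos
    calc (1 - 3 / (3 + L n)) * ((d n : ℝ) / L n) = d n / (3 + L n) := by
          field_simp
          ring
      _ ≤ _ := div_le_div_of_nonneg_left (Nat.cast_nonneg _) (by linarith) h1
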